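/- Let $\mathbb N$ be the set of positive integers with the metric $d(n,m)=|n-m|$, and let $\mathbf{I}\mathbb{N}_{\infty}$ be the monoid of all partial cofinite isometries of $\mathbb N$, i.e. of all partial one-to-one maps $\gamma\colon\mathbb N\rightharpoonup\mathbb N$ such that $\mathbb N\setminus\operatorname{dom}\gamma$ and $\mathbb N\setminus\operatorname{ran}\gamma$ are finite and $d((x)\gamma,(y)\gamma)=d(x,y)$ for all $x,y\in\operatorname{dom}\gamma$, with the composition of partial maps (written on the right, so $\gamma\delta$ means first $\gamma$, then $\delta$). Let $\mathscr{C}_{\mathbb N}$ be the subsemigroup of $\mathbf{I}\mathbb{N}_{\infty}$ generated by the maps $\alpha\colon\mathbb N\to\mathbb N\setminus\{1\}$, $(n)\alpha=n+1$, and $\beta\colon\mathbb N\setminus\{1\}\to\mathbb N$, $(n)\beta=n-1$; it is isomorphic to the bicyclic monoid. Theorem 3.15. Let $S$ be a subsemigroup of $\mathbf{I}\mathbb{N}_{\infty}$ which contains $\mathscr{C}_{\mathbb N}$. Let $S_I$ be a Hausdorff locally compact semitopological semigroup (a semigroup with a topology in which all left and right translations are continuous) such that $S_I=S\sqcup I$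 is the disjoint union of (an isomorphic copy of) the semigroup $S$, as a subsemigroup, and a compact two-sided ideal $I$ of $S_I$. Then $S_I$ is compact or the ideal $I$ is open in $S_I$. -/

import Mathlib

/-- The symmetric inverse monoid of all partial one-to-one selfmaps of `X`. Maps act on the right,
so `f * g` means "first `f`, then `g`". -/
instance PEquiv.instMonoidSelf {X : Type*} : Monoid (X ≃. X) where
  mul f g := f.trans g
  one := PEquiv.refl X
  mul_assoc := PEquiv.trans_assoc
  one_mul := PEquiv.refl_trans
  mul_one := PEquiv.trans_refl

theorem PEquiv.mul_def {X : Type*} (f g : X ≃. X) : f * g = f.trans g := rfl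

theorem PEquiv.one_def {X : Type*} : (1 : X ≃. X) = PEquiv.refl X := rfl

/-- A partial bijection of `X` is cofinite if the complements of its domain and of its range are
finite. -/
def PEquiv.IsCofinite {X : Type*} (f : X ≃. X) : Prop :=
  {x | f x = none}.Finite ∧ {y | f.symm y = none}.Finite

/-- A partial map of a metric space is a partial isometry if it preserves the distance between
any two points of its domain. -/
def PEquiv.IsPartialIsometry {X : Type*} [Dist X] (f : X ≃. X) : Prop :=
  ∀ x y x' y' : X, f x = some x' → f y = some y' → dist x' y' = dist x y

theorem PEquiv.finite_trans_eq_none {X : Type*} {f g : X ≃. X}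
    (hf : {x | f x = none}.Finite) (hg : {x | g x = none}.Finite) :
    {x | (f.trans g) x = none}.Finite := by
  have h : {x | ∃ y, f x = some y ∧ g y = none}.Finite := by
    have h1 : ((fun y => f.symm y) '' {x | g x = none}).Finite := hg.image _
    refine (h1.preimage (f := fun x : X => some x) ?_).subset ?_
    · intro a _ b _ hab
      exact Option.some.inj hab
    · rintro x ⟨y, hxy, hy⟩
      exact ⟨y, hy, f.eq_some_iff.mpr hxy⟩
  refine (hf.union h).subset ?_
  intro x hx
  cases hfx : f x with
  | none => exact Or.inl hfx
  | some y =>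
    refine Or.inr ⟨y, hfx, ?_⟩
    have hx' : (f.trans g) x = none := hx
    rw [PEquiv.trans_eq_none] at hx'
    cases hgy : g y with
    | none => rfl
    | some c => exact ((hx' y c).elim (fun h => (h hfx).elim) (fun h => (h hgy).elim))

/-- The monoid of all partial cofinite isometries of the set of positive integers with the usual
metric `|n - m|`. -/
def INInfty : Submonoid (ℕ+ ≃. ℕ+) where
  carrier := {f | f.IsCofinite ∧ f.IsPartialIsometry}
  mul_mem' := by
    rintro f g ⟨⟨hf1, hf2⟩, hf3⟩ ⟨⟨hg1, hg2⟩, hg3⟩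
    refine ⟨⟨PEquiv.finite_trans_eq_none hf1 hg1, ?_⟩, ?_⟩
    · rw [PEquiv.mul_def, PEquiv.symm_trans_rev]
      exact PEquiv.finite_trans_eq_none hg2 hf2
    · intro x y x' y' hx hy
      obtain ⟨u, hu, hu'⟩ := (PEquiv.trans_eq_some f g x x').mp hx
      obtain ⟨v, hv, hv'⟩ := (PEquiv.trans_eq_some f g y y').mp hy
      rw [hg3 u v x' y' hu' hv', hf3 x y u v hu hv]
  one_mem' := by
    refine ⟨⟨?_, ?_⟩, ?_⟩
    · simp [PEquiv.one_def]
    · simp [PEquiv.one_def]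
    · intro x y x' y' hx hy
      rw [PEquiv.one_def, PEquiv.refl_apply, Option.some.injEq] at hx hy
      rw [hx, hy]

/-- The map `α : n ↦ n + 1`, with domain all positive integers and range all integers `≥ 2`. -/
def shiftUp : ℕ+ ≃. ℕ+ where
  toFun n := some (n + 1)
  invFun n := if n = 1 then none else some (n - 1)
  inv a b := by
    by_cases hb : b = 1
    · subst hb
      simp only [if_true, reduceCtorEq, Option.some.injEq, false_iff]
      exact ne_of_gt (PNat.lt_add_left 1 a)
    · rw [if_neg hb, Option.some.injEq, Option.some.injEq]
      have h1 : 1 < b := lt_of_le_of_ne (one_le : (1 : ℕ+) ≤ b) (Ne.symm hb)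
      constructor
      · rintro rfl
        exact PNat.sub_add_of_lt h1
      · rintro rfl
        exact PNat.add_sub

/-- The map `β : n ↦ n - 1`, with domain all integers `≥ 2` and range all positive integers. -/
def shiftDown : ℕ+ ≃. ℕ+ := shiftUp.symm

/-- The semigroup of partial maps generated by `α` and `β`, a copy of the bicyclic monoid. It
contains the identity map, which is the product `α * β`. -/
def bicyclicN : Subsemigroup (ℕ+ ≃. ℕ+) :=
  Subsemigroup.closure {shiftUp, shiftDown}

/-- A two-sided ideal of a semigroup. -/
def IsSemigroupIdeal {X : Type*} [Mul X] (I : Set X) : Prop :=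
  ∀ a ∈ I, ∀ x : X, x * a ∈ I ∧ a * x ∈ I

/-! Each partial cofinite isometry is uniquely `β ^ i * c * α ^ j` with `c` fixing `1`, hence `c` a
partial identity (`gridElement_bijective`). So `S` is countable and splits into quarter-plane grids
indexed by such `c`. As `I` is closed, the copy of `S` is open, and by Baire it has an isolated
point. Translations of `S` are finite-to-one (`INInfty.finite_setOf_mul_left_eq` and its right
version), so pulling back along them isolates every point of `S`. Let `K` be a compact neighbourhood
of `I` and `A` the part of `S` in its interior. For open `V ⊇ I` the set `K \ V` is compact and
discrete, hence finite. Translations are continuous and preserve `I`, so each moves only finitely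
many points of `A` out of `A`. By `Set.Infinite.finite_compl_of_translations`, `A` is finite or
cofinite: then `I` is open or `X` is compact, respectively. -/

open Set

/-! ### Combinatorics of almost invariant sets in grids -/

/-- A subset of a disjoint union of quarter-plane grids, indexed by `T`, which up to finitely many
exceptions is closed under the grid moves and under passing from any grid to the grid `o` and
back, is finite or cofinite. -/
theorem Set.Infinite.finite_compl_of_grid {T : Type*} (o : T) {A : Set (ℕ × ℕ × T)}
    (hA : A.Infinite)
    (h1 : {p : ℕ × ℕ × T | ¬ (p ∈ A ↔ (p.1 + 1, p.2.1, p.2.2) ∈ A)}.Finite)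
    (h2 : {p : ℕ × ℕ × T | ¬ (p ∈ A ↔ (p.1, p.2.1 + 1, p.2.2) ∈ A)}.Finite)
    (hto : ∀ c, ∃ m, {j : ℕ | (0, j, c) ∈ A ∧ (0, m + j, o) ∉ A}.Finite)
    (hfrom : ∀ c, {j : ℕ | (0, j, o) ∈ A ∧ (0, j, c) ∉ A}.Finite) :
    Aᶜ.Finite := by
  obtain ⟨F, hF⟩ : ∃ F : Set (ℕ × ℕ × T), F = {p | ¬ (p ∈ A ↔ (p.1 + 1, p.2.1, p.2.2) ∈ A)} ∪
    {p | ¬ (p ∈ A ↔ (p.1, p.2.1 + 1, p.2.2) ∈ A)} := ⟨_, rfl⟩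
  have hFf : F.Finite := hF ▸ h1.union h2
  have e1 : ∀ i j c, (i, j, c) ∉ F → ((i, j, c) ∈ A ↔ (i + 1, j, c) ∈ A) := by
    intro i j c h
    by_contra h'
    exact h (hF ▸ Or.inl h')
  have e2 : ∀ i j c, (i, j, c) ∉ F → ((i, j, c) ∈ A ↔ (i, j + 1, c) ∈ A) := by
    intro i j c h
    by_contra h'
    exact h (hF ▸ Or.inr h')
  obtain ⟨N1, hN1⟩ := (hFf.image (fun p => p.1)).bddAbove
  obtain ⟨N2, hN2⟩ := (hFf.image (fun p => p.2.1)).bddAbove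
  obtain ⟨N, hN⟩ : ∃ N, N = max N1 N2 := ⟨_, rfl⟩
  have hFN : ∀ i j c, (i, j, c) ∈ F → i ≤ N ∧ j ≤ N := by
    intro i j c h
    have a1 : i ≤ N1 := hN1 ⟨_, h, rfl⟩
    have a2 : j ≤ N2 := hN2 ⟨_, h, rfl⟩
    omega
  -- a column or row free of exceptional points lies in `A` as soon as one of its points does
  have row : ∀ i c, (∀ j, (i, j, c) ∉ F) → ∀ j, ((i, 0, c) ∈ A ↔ (i, j, c) ∈ A) := by
    intro i c h j
    induction j with
    | zero => rfl
    | succ j ih => rw [ih, e2 i j c (h j)]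
  have col : ∀ j c, (∀ i, (i, j, c) ∉ F) → ∀ i, ((0, j, c) ∈ A ↔ (i, j, c) ∈ A) := by
    intro j c h i
    induction i with
    | zero => rfl
    | succ i ih => rw [ih, e1 i j c (h i)]
  -- Lines of index above `N` avoid `F`. Every point outside the box `[0, N]²` lies on one, and such
  -- lines connect it to `(N + 1, N + 1)`.
  have outer : ∀ i j c, N < i ∨ N < j → ((i, j, c) ∈ A ↔ (N + 1, N + 1, c) ∈ A) := by
    have big1 : ∀ i c, N < i → ∀ j, (i, j, c) ∉ F := fun i c h j hF => by
      have := hFN _ _ _ hF; omega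
    have big2 : ∀ j c, N < j → ∀ i, (i, j, c) ∉ F := fun j c h i hF => by
      have := hFN _ _ _ hF; omega
    rintro i j c (h | h)
    · rw [← row i c (big1 i c h) j, row i c (big1 i c h) (N + 1),
        ← col (N + 1) c (big2 _ c (Nat.lt_succ_self N)) i,
        col (N + 1) c (big2 _ c (Nat.lt_succ_self N)) (N + 1)]
    · rw [← col j c (big2 j c h) i, col j c (big2 j c h) (N + 1),
        ← row (N + 1) c (big1 _ c (Nat.lt_succ_self N)) j,
        row (N + 1) c (big1 _ c (Nat.lt_succ_self N)) (N + 1)]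
  -- `T` may be infinite, so bounding the box is not enough: only the finitely many grids that meet
  -- `F` can be split by `A`.
  have whole : ∀ c, (∀ i j, (i, j, c) ∉ F) → ∀ i j, ((i, j, c) ∈ A ↔ (N + 1, N + 1, c) ∈ A) := by
    intro c h i j
    rw [← row i c (h i) j, row i c (h i) (N + 1)]
    exact outer _ _ _ (Or.inr (Nat.lt_succ_self N))
  have finC : ∀ B : Set (ℕ × ℕ × T),
      (∀ i j c, (i, j, c) ∈ B → i ≤ N ∧ j ≤ N ∧ ∃ i' j', (i', j', c) ∈ F) → B.Finite := by
    intro B hB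
    refine ((finite_Iic N).prod ((finite_Iic N).prod (hFf.image (fun p => p.2.2)))).subset ?_
    rintro ⟨i, j, c⟩ h
    obtain ⟨a, b, i', j', h'⟩ := hB i j c h
    exact ⟨a, b, _, h', rfl⟩
  obtain ⟨c, hc⟩ : ∃ c, (N + 1, N + 1, c) ∈ A := by
    by_contra! hno
    refine hA (finC A ?_)
    intro i j c h
    have h' : ¬ (N < i ∨ N < j) := fun h' => hno c ((outer i j c h').1 h)
    refine ⟨by omega, by omega, ?_⟩
    by_contra! h''
    exact hno c ((whole c h'' i j).1 h)
  have tail : ∀ {P : ℕ → Prop}, {j | P j}.Finite → ∃ j, N < j ∧ ¬ P j := by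
    intro P hP
    obtain ⟨j, hj, hj'⟩ := (Ioi_infinite N).exists_notMem_finite hP
    exact ⟨j, hj, hj'⟩
  have ho : (N + 1, N + 1, o) ∈ A := by
    obtain ⟨m, hm⟩ := hto c
    obtain ⟨j, hj, hj'⟩ := tail hm
    have h3 := (outer 0 j c (Or.inr hj)).2 hc
    have h4 : (0, m + j, o) ∈ A := by
      by_contra h
      exact hj' ⟨h3, h⟩
    exact (outer 0 (m + j) o (Or.inr (by omega))).1 h4
  have hall : ∀ c, (N + 1, N + 1, c) ∈ A := by
    intro c
    obtain ⟨j, hj, hj'⟩ := tail (hfrom c)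
    have h3 := (outer 0 j o (Or.inr hj)).2 ho
    have h4 : (0, j, c) ∈ A := by
      by_contra h
      exact hj' ⟨h3, h⟩
    exact (outer 0 j c (Or.inr hj)).1 h4
  refine finC _ ?_
  intro i j c h
  have h' : ¬ (N < i ∨ N < j) := fun h' => h ((outer i j c h').2 (hall c))
  refine ⟨by omega, by omega, ?_⟩
  by_contra! h''
  exact h ((whole c h'' i j).2 (hall c))

/-! ### Powers of the shifts -/

theorem PEquiv.mul_eq_some {X : Type*} {f g : X ≃. X} {a c : X} :
    (f * g) a = some c ↔ ∃ b, f a = some b ∧ g b = some c :=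
  PEquiv.trans_eq_some f g a c

theorem PEquiv.ext_some {X : Type*} {f g : X ≃. X}
    (h : ∀ a b, f a = some b ↔ g a = some b) : f = g :=
  PEquiv.ext fun a => Option.ext fun b => h a b

theorem PEquiv.one_eq_some {X : Type*} {a b : X} : (1 : X ≃. X) a = some b ↔ a = b := by
  rw [PEquiv.one_def, PEquiv.refl_apply, Option.some.injEq]

theorem shiftUp_eq_some {n m : ℕ+} : shiftUp n = some m ↔ (m : ℕ) = n + 1 := by
  change some (n + 1) = some m ↔ _
  rw [Option.some.injEq, ← PNat.coe_inj, PNat.add_coe, PNat.one_coe, eq_comm]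

theorem shiftDown_eq_some {n m : ℕ+} : shiftDown n = some m ↔ (n : ℕ) = m + 1 := by
  rw [shiftDown, PEquiv.eq_some_iff, shiftUp_eq_some]

theorem shiftUp_pow_eq_some {i : ℕ} {n m : ℕ+} :
    (shiftUp ^ i) n = some m ↔ (m : ℕ) = n + i := by
  induction i generalizing n m with
  | zero => rw [pow_zero, PEquiv.one_eq_some, add_zero, PNat.coe_inj, eq_comm]
  | succ i ih =>
    rw [pow_succ, PEquiv.mul_eq_some]
    constructor
    · rintro ⟨b, hb, hb'⟩
      rw [ih] at hb
      rw [shiftUp_eq_some] at hb'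
      omega
    · intro h
      refine ⟨⟨n + i, by positivity⟩, ih.2 rfl, shiftUp_eq_some.2 ?_⟩
      rw [h, PNat.mk_coe, add_assoc]

theorem shiftDown_pow_eq_some {i : ℕ} {n m : ℕ+} :
    (shiftDown ^ i) n = some m ↔ (n : ℕ) = m + i := by
  induction i generalizing n m with
  | zero => rw [pow_zero, PEquiv.one_eq_some, add_zero, PNat.coe_inj]
  | succ i ih =>
    rw [pow_succ', PEquiv.mul_eq_some]
    constructor
    · rintro ⟨b, hb, hb'⟩
      rw [ih] at hb'
      rw [shiftDown_eq_some] at hb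
      omega
    · intro h
      refine ⟨⟨m + i, by positivity⟩, shiftDown_eq_some.2 ?_, ih.2 rfl⟩
      rw [h, PNat.mk_coe, add_assoc]

theorem shiftUp_pow_mul_shiftDown_pow (i : ℕ) : shiftUp ^ i * shiftDown ^ i = 1 := by
  refine PEquiv.ext_some fun a b => ?_
  rw [PEquiv.mul_eq_some, PEquiv.one_eq_some]
  constructor
  · rintro ⟨c, h1, h2⟩
    rw [shiftUp_pow_eq_some] at h1
    rw [shiftDown_pow_eq_some] at h2
    exact PNat.eq (by omega)
  · rintro rfl
    exact ⟨⟨a + i, by positivity⟩, shiftUp_pow_eq_some.2 rfl, shiftDown_pow_eq_some.2 rfl⟩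

theorem shiftUp_mul_shiftDown : shiftUp * shiftDown = 1 := by
  simpa using shiftUp_pow_mul_shiftDown_pow 1

/-! ### Rigidity of cofinite isometries and finiteness of translation fibres -/

/-- A cofinite partial map is defined at all sufficiently large points. -/
theorem PEquiv.IsCofinite.exists_gt {f : ℕ+ ≃. ℕ+} (hf : f.IsCofinite) :
    ∃ m : ℕ, ∀ n : ℕ+, m < n → ∃ n', f n = some n' := by
  obtain ⟨m, hm⟩ := hf.1.bddAbove
  refine ⟨m, fun n hn => ?_⟩
  cases h : f n with
  | none =>
    have h1 : n ≤ m := hm h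
    have h2 : (n : ℕ) ≤ m := h1
    omega
  | some n' => exact ⟨n', rfl⟩

theorem PNat.natAbs_of_dist_eq {a b c d : ℕ+} (h : dist a b = dist c d) :
    ((a : ℤ) - b).natAbs = ((c : ℤ) - d).natAbs := by
  rw [PNat.dist_eq, PNat.dist_eq] at h
  have h' : |((a : ℕ) : ℤ) - (b : ℕ)| = |((c : ℕ) : ℤ) - (d : ℕ)| := by exact_mod_cast h
  rw [Int.abs_eq_natAbs, Int.abs_eq_natAbs] at h'
  exact_mod_cast h'

/-- A partial cofinite isometry of the positive integers is a restriction of a translation. -/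
theorem INInfty.add_eq_add {x : ℕ+ ≃. ℕ+} (hx : x ∈ INInfty) {n m n' m' : ℕ+}
    (hn : x n = some n') (hm : x m = some m') : (n' : ℕ) + m = m' + n := by
  obtain ⟨N, hN⟩ := hx.1.exists_gt
  -- The reference point is so far out that `p' < n'` or `p' < m'` would force `p' ≤ 0`; this fixes
  -- the signs in both distance equations.
  obtain ⟨p', hp⟩ := hN ⟨N + n + m + n' + m' + 1, by positivity⟩ (by rw [PNat.mk_coe]; omega)
  have h1 := PNat.natAbs_of_dist_eq (hx.2 _ _ _ _ hp hn)
  have h2 := PNat.natAbs_of_dist_eq (hx.2 _ _ _ _ hp hm)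
  rw [PNat.mk_coe] at h1 h2
  push_cast at h1 h2
  have := p'.pos
  omega

theorem INInfty.symm_mem {x : ℕ+ ≃. ℕ+} (hx : x ∈ INInfty) : x.symm ∈ INInfty := by
  refine ⟨⟨hx.1.2, hx.1.1⟩, ?_⟩
  intro a b a' b' ha hb
  rw [PEquiv.eq_some_iff] at ha hb
  exact (hx.2 _ _ _ _ ha hb).symm

/-- The product determines `t` on the range of `s`. On the finite complement `C` of that range, `t`
is the same translation as far out, so only the choice of undefined points in `C` remains free. -/
theorem INInfty.finite_setOf_mul_left_eq {s : ℕ+ ≃. ℕ+} (hs : s ∈ INInfty) (u : ℕ+ ≃. ℕ+) :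
    {t | t ∈ INInfty ∧ s * t = u}.Finite := by
  obtain ⟨C, hC⟩ : ∃ C, C = {y | s.symm y = none} := ⟨_, rfl⟩
  have hCf : C.Finite := hC ▸ hs.1.2
  refine Set.Finite.of_finite_image (f := fun t : ℕ+ ≃. ℕ+ => {n | n ∈ C ∧ t n = none})
    (hCf.finite_subsets.subset ?_) ?_
  · rintro _ ⟨t, -, rfl⟩ n hn
    exact hn.1
  · rintro t ⟨ht, htu⟩ t' ⟨ht', htu'⟩ heq
    have off : ∀ n, n ∉ C → t n = t' n := by
      intro n hn
      cases h : s.symm n with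
      | none => exact (hn (hC ▸ h)).elim
      | some a =>
        rw [PEquiv.eq_some_iff] at h
        refine Option.ext fun b => ?_
        have key : ∀ v : ℕ+ ≃. ℕ+, v n = some b ↔ (s * v) a = some b := by
          intro v
          rw [PEquiv.mul_eq_some]
          constructor
          · exact fun hv => ⟨n, h, hv⟩
          · rintro ⟨n', hn', hv⟩
            rw [h, Option.some.injEq] at hn'
            rwa [hn']
        rw [key, key, htu, htu']
    obtain ⟨N, hN⟩ := ht.1.exists_gt
    obtain ⟨M, hM⟩ := hCf.bddAbove
    obtain ⟨p, hpn, hpC⟩ : ∃ p : ℕ+, N < p ∧ p ∉ C := by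
      refine ⟨⟨N + M + 1, by positivity⟩, by rw [PNat.mk_coe]; omega, fun h => ?_⟩
      have h1 : (N + M + 1 : ℕ) ≤ M := hM h
      omega
    obtain ⟨p', hp⟩ := hN p hpn
    have hp' : t' p = some p' := off p hpC ▸ hp
    refine PEquiv.ext fun n => ?_
    by_cases hn : n ∈ C
    · have h1 : t n = none ↔ t' n = none := by
        have := congrArg (n ∈ ·) heq
        simpa [hn] using this
      cases h : t n with
      | none => exact (h1.1 h).symm
      | some a =>
        cases h' : t' n with
        | none => rw [h1.2 h'] at h; exact h.symm
        | some b =>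
          have h2 := INInfty.add_eq_add ht h hp
          have h3 := INInfty.add_eq_add ht' h' hp'
          rw [Option.some.injEq]
          exact PNat.eq (by omega)
    · exact off n hn

theorem INInfty.finite_setOf_mul_right_eq {s : ℕ+ ≃. ℕ+} (hs : s ∈ INInfty) (u : ℕ+ ≃. ℕ+) :
    {t | t ∈ INInfty ∧ t * s = u}.Finite := by
  refine Set.Finite.of_finite_image (f := PEquiv.symm)
    ((INInfty.finite_setOf_mul_left_eq (INInfty.symm_mem hs) u.symm).subset ?_)
    PEquiv.symm_bijective.injective.injOn
  rintro _ ⟨t, ⟨ht, rfl⟩, rfl⟩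
  exact ⟨INInfty.symm_mem ht, (PEquiv.symm_trans_rev t s).symm⟩

/-! ### The normal form `β ^ i * c * α ^ j` -/

/-- A partial cofinite isometry fixing the point `1` fixes every point of its domain. -/
theorem INInfty.eq_of_apply_one {c : ℕ+ ≃. ℕ+} (hc : c ∈ INInfty) (h1 : c 1 = some 1) {n m : ℕ+}
    (h : c n = some m) : n = m := by
  have := INInfty.add_eq_add hc h h1
  exact PNat.eq (by omega)

/-- A partial identity is determined by the finite complement of its domain. -/
theorem INInfty.countable_setOf_apply_one :
    {c : ℕ+ ≃. ℕ+ | c ∈ INInfty ∧ c 1 = some 1}.Countable := by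
  refine Set.MapsTo.countable_of_injOn (f := fun c => {n | c n = none})
    (t := {s : Set ℕ+ | s.Finite}) (fun c hc => hc.1.1.1) ?_ Set.Countable.ofPred_finite
  rintro c ⟨hc, hc1⟩ c' ⟨hc', hc1'⟩ heq
  refine PEquiv.ext fun n => ?_
  have h1 : c n = none ↔ c' n = none := by
    have := congrArg (n ∈ ·) heq
    simpa using this
  cases h : c n with
  | none => exact (h1.1 h).symm
  | some a =>
    cases h' : c' n with
    | none => rw [h1.2 h'] at h; exact h.symm
    | some b =>
      rw [← INInfty.eq_of_apply_one hc hc1 h, ← INInfty.eq_of_apply_one hc' hc1' h']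

/-- A large shift jumps past all gaps of `c`. This links the grid of `c` to the grid of the
identity. -/
theorem INInfty.exists_shiftUp_pow_mul_eq {c : ℕ+ ≃. ℕ+} (hc : c ∈ INInfty)
    (h1 : c 1 = some 1) : ∃ m : ℕ, shiftUp ^ m * c = shiftUp ^ m := by
  obtain ⟨m, hm⟩ := hc.1.exists_gt
  refine ⟨m, PEquiv.ext_some fun a b => ?_⟩
  rw [PEquiv.mul_eq_some]
  constructor
  · rintro ⟨n, hn, hn'⟩
    rwa [← INInfty.eq_of_apply_one hc h1 hn']
  · intro h
    refine ⟨b, h, ?_⟩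
    rw [shiftUp_pow_eq_some] at h
    have := a.pos
    obtain ⟨b', hb'⟩ := hm b (by omega)
    rw [hb', INInfty.eq_of_apply_one hc h1 hb']

/-- Every partial cofinite isometry is a map fixing `1`, moved by powers of the shifts. -/
theorem INInfty.exists_eq_shiftDown_pow_mul {x : ℕ+ ≃. ℕ+} (hx : x ∈ INInfty) :
    ∃ i j : ℕ, (shiftUp ^ i * x * shiftDown ^ j) 1 = some 1 ∧
      x = shiftDown ^ i * (shiftUp ^ i * x * shiftDown ^ j) * shiftUp ^ j := by
  classical
  have hex : ∃ d : ℕ, ∃ n n' : ℕ+, (n : ℕ) = d ∧ x n = some n' := by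
    obtain ⟨m, hm⟩ := hx.1.exists_gt
    obtain ⟨n', hn'⟩ := hm ⟨m + 1, by positivity⟩ (by rw [PNat.mk_coe]; omega)
    exact ⟨_, _, n', rfl, hn'⟩
  obtain ⟨d, r, hd, hdr⟩ := Nat.find_spec hex
  have hmin : ∀ n n', x n = some n' → (d : ℕ) ≤ n ∧ (r : ℕ) ≤ n' := by
    intro n n' h
    have h1 : (d : ℕ) ≤ n := hd ▸ Nat.find_min' hex ⟨n, n', rfl, h⟩
    have := INInfty.add_eq_add hx h hdr
    omega
  have hdp := d.pos
  have hrp := r.pos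
  -- `d` and `r` are the least points of the domain and range. `β ^ i * α ^ i` is the identity on
  -- points `> i`, hence the shift by one.
  refine ⟨d - 1, r - 1, ?_, ?_⟩
  · rw [PEquiv.mul_eq_some]
    refine ⟨r, PEquiv.mul_eq_some.2 ⟨d, shiftUp_pow_eq_some.2 ?_, hdr⟩,
      shiftDown_pow_eq_some.2 ?_⟩ <;> rw [PNat.one_coe] <;> omega
  · have hl : shiftDown ^ ((d : ℕ) - 1) * (shiftUp ^ ((d : ℕ) - 1) * x) = x := by
      refine PEquiv.ext_some fun a b => ?_
      simp only [PEquiv.mul_eq_some, shiftDown_pow_eq_some, shiftUp_pow_eq_some]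
      constructor
      · rintro ⟨n, hn, m, hm, h⟩
        rwa [show a = m from PNat.eq (by omega)]
      · intro h
        have := hmin a b h
        exact ⟨⟨a - (d - 1), by omega⟩, by rw [PNat.mk_coe]; omega, a,
          by rw [PNat.mk_coe]; omega, h⟩
    have hr : x * (shiftDown ^ ((r : ℕ) - 1) * shiftUp ^ ((r : ℕ) - 1)) = x := by
      refine PEquiv.ext_some fun a b => ?_
      simp only [PEquiv.mul_eq_some, shiftDown_pow_eq_some, shiftUp_pow_eq_some]
      constructor
      · rintro ⟨n, h, m, hm, hn⟩
        rwa [show b = n from PNat.eq (by omega)]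
      · intro h
        have := hmin a b h
        exact ⟨b, h, ⟨b - (r - 1), by omega⟩, by rw [PNat.mk_coe]; omega,
          by rw [PNat.mk_coe]; omega⟩
    rw [← mul_assoc] at hl
    simp only [mul_assoc] at hl hr ⊢
    rw [hr, hl]

/-- The least domain point is `i + 1`, with image `j + 1`, so `i` and `j` can be read off; `α ^ i *
β ^ i = 1` then recovers `c`. -/
theorem INInfty.shiftDown_pow_mul_injective {c c' : ℕ+ ≃. ℕ+} {i j i' j' : ℕ}
    (hc : c ∈ INInfty) (h1 : c 1 = some 1) (hc' : c' ∈ INInfty) (h1' : c' 1 = some 1)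
    (h : shiftDown ^ i * c * shiftUp ^ j = shiftDown ^ i' * c' * shiftUp ^ j') :
    i = i' ∧ j = j' ∧ c = c' := by
  have val : ∀ {c : ℕ+ ≃. ℕ+} {i j : ℕ}, c ∈ INInfty → c 1 = some 1 → ∀ {a b},
      (shiftDown ^ i * c * shiftUp ^ j) a = some b → i < a ∧ (a : ℕ) + j = b + i := by
    intro c i j hc h1 a b h
    simp only [PEquiv.mul_eq_some, shiftDown_pow_eq_some, shiftUp_pow_eq_some] at h
    obtain ⟨n, ⟨m, hm, hc2⟩, hn⟩ := h
    have := INInfty.eq_of_apply_one hc h1 hc2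
    subst this
    have := m.pos
    omega
  have val' : ∀ {c : ℕ+ ≃. ℕ+} (i j : ℕ), c 1 = some 1 →
      (shiftDown ^ i * c * shiftUp ^ j) (Nat.succPNat i) = some (Nat.succPNat j) := by
    intro c i j h1
    simp only [PEquiv.mul_eq_some, shiftDown_pow_eq_some, shiftUp_pow_eq_some]
    exact ⟨1, ⟨1, Nat.add_comm i 1, h1⟩, Nat.add_comm j 1⟩
  have e1 := val hc' h1' (h ▸ val' (c := c) i j h1)
  have e2 := val hc h1 (h.symm ▸ val' (c := c') i' j' h1')
  simp only [Nat.succPNat_coe] at e1 e2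
  obtain rfl : i = i' := by omega
  obtain rfl : j = j' := by omega
  refine ⟨rfl, rfl, ?_⟩
  have cancel : ∀ c : ℕ+ ≃. ℕ+,
      shiftUp ^ i * (shiftDown ^ i * c * shiftUp ^ j) * shiftDown ^ j = c := by
    intro c
    rw [mul_assoc, mul_assoc, mul_assoc, shiftUp_pow_mul_shiftDown_pow, mul_one, ← mul_assoc,
      shiftUp_pow_mul_shiftDown_pow, one_mul]
  rw [← cancel c, h, cancel c']

/-! ### Grid coordinates on `S` -/

theorem shiftUp_mem_bicyclicN : shiftUp ∈ bicyclicN :=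
  Subsemigroup.subset_closure (Or.inl rfl)

theorem shiftDown_mem_bicyclicN : shiftDown ∈ bicyclicN :=
  Subsemigroup.subset_closure (Or.inr rfl)

theorem one_mem_bicyclicN : 1 ∈ bicyclicN :=
  shiftUp_mul_shiftDown ▸ mul_mem shiftUp_mem_bicyclicN shiftDown_mem_bicyclicN

theorem shiftUp_pow_mem_bicyclicN (i : ℕ) : shiftUp ^ i ∈ bicyclicN := by
  induction i with
  | zero => exact one_mem_bicyclicN
  | succ i ih => exact pow_succ shiftUp i ▸ mul_mem ih shiftUp_mem_bicyclicN

theorem shiftDown_pow_mem_bicyclicN (i : ℕ) : shiftDown ^ i ∈ bicyclicN := by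
  induction i with
  | zero => exact one_mem_bicyclicN
  | succ i ih => exact pow_succ shiftDown i ▸ mul_mem ih shiftDown_mem_bicyclicN

section BetweenBicyclicAndIsometries

variable {S : Subsemigroup (ℕ+ ≃. ℕ+)}

/-- The product `β ^ i * c * α ^ j`, as an element of a semigroup `S` containing the bicyclic
monoid, for `c` in `S` with `c 1 = 1`. -/
def gridElement (hCS : bicyclicN ≤ S) (p : ℕ × ℕ × {c : S // c.1 1 = some 1}) : S :=
  ⟨shiftDown ^ p.1 * p.2.2.1.1 * shiftUp ^ p.2.1,
    mul_mem (mul_mem (hCS (shiftDown_pow_mem_bicyclicN _)) p.2.2.1.2)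
      (hCS (shiftUp_pow_mem_bicyclicN _))⟩

theorem gridElement_bijective (hS : S ≤ INInfty.toSubsemigroup) (hCS : bicyclicN ≤ S) :
    Function.Bijective (gridElement hCS) := by
  constructor
  · rintro ⟨i, j, ⟨⟨c, hc⟩, h1⟩⟩ ⟨i', j', ⟨⟨c', hc'⟩, h1'⟩⟩ h
    obtain ⟨rfl, rfl, rfl⟩ := INInfty.shiftDown_pow_mul_injective (hS hc) h1 (hS hc') h1'
      (congrArg Subtype.val h)
    rfl
  · rintro ⟨x, hx⟩
    obtain ⟨i, j, h1, h⟩ := INInfty.exists_eq_shiftDown_pow_mul (hS hx)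
    exact ⟨(i, j, ⟨⟨_, mul_mem (mul_mem (hCS (shiftUp_pow_mem_bicyclicN i)) hx)
      (hCS (shiftDown_pow_mem_bicyclicN j))⟩, h1⟩), Subtype.ext h.symm⟩

theorem countable_of_le_INInfty (hS : S ≤ INInfty.toSubsemigroup) (hCS : bicyclicN ≤ S) :
    Countable S := by
  have : Countable {c : S // c.1 1 = some 1} := by
    have := INInfty.countable_setOf_apply_one.to_subtype
    refine Function.Injective.countable
      (f := fun c : {c : S // c.1 1 = some 1} =>
        (⟨c.1.1, hS c.1.2, c.2⟩ : {c : ℕ+ ≃. ℕ+ | c ∈ INInfty ∧ c 1 = some 1})) ?_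
    intro a b h
    exact Subtype.ext (Subtype.ext (congrArg (fun z => z.1) h))
  exact (gridElement_bijective hS hCS).2.countable

/-- An infinite subset of `S` that is closed under translations up to finitely many exceptions is
cofinite. -/
theorem Set.Infinite.finite_compl_of_translations (hS : S ≤ INInfty.toSubsemigroup)
    (hCS : bicyclicN ≤ S) {A : Set S} (hA : A.Infinite)
    (hl : ∀ s : S, {x | x ∈ A ∧ s * x ∉ A}.Finite)
    (hr : ∀ s : S, {x | x ∈ A ∧ x * s ∉ A}.Finite) : Aᶜ.Finite := by
  obtain ⟨f, hf⟩ : ∃ f, f = gridElement hCS := ⟨_, rfl⟩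
  have hbij : Function.Bijective f := hf ▸ gridElement_bijective hS hCS
  obtain ⟨a, ha⟩ : ∃ a : S, a.1 = shiftUp := ⟨⟨_, hCS shiftUp_mem_bicyclicN⟩, rfl⟩
  obtain ⟨b, hb⟩ : ∃ b : S, b.1 = shiftDown := ⟨⟨_, hCS shiftDown_mem_bicyclicN⟩, rfl⟩
  have fval : ∀ i j c, (f (i, j, c)).1 = shiftDown ^ i * c.1.1 * shiftUp ^ j := by
    intro i j c
    rw [hf]
    rfl
  have hbf : ∀ i j c, b * f (i, j, c) = f (i + 1, j, c) := by
    intro i j c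
    refine Subtype.ext ?_
    rw [MulMemClass.coe_mul, fval, fval, hb, pow_succ' shiftDown]
    simp only [mul_assoc]
  have hab : ∀ x : S, a * (b * x) = x := by
    intro x
    refine Subtype.ext ?_
    rw [MulMemClass.coe_mul, MulMemClass.coe_mul, ha, hb, ← mul_assoc, shiftUp_mul_shiftDown,
      one_mul]
  have hfa : ∀ i j c, f (i, j, c) * a = f (i, j + 1, c) := by
    intro i j c
    refine Subtype.ext ?_
    rw [MulMemClass.coe_mul, fval, fval, ha, pow_succ shiftUp]
    simp only [mul_assoc]
  have hba : ∀ x : S, x * a * b = x := by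
    intro x
    refine Subtype.ext ?_
    rw [MulMemClass.coe_mul, MulMemClass.coe_mul, ha, hb, mul_assoc, shiftUp_mul_shiftDown,
      mul_one]
  have hfin : ∀ {B : Set S}, B.Finite → (f ⁻¹' B).Finite :=
    fun hB => hB.preimage hbij.1.injOn
  have hcol : Function.Injective fun x : S => b * x := fun x y h => by
    rw [← hab x, ← hab y]
    exact congrArg (a * ·) h
  have hrow : Function.Injective fun x : S => x * a := fun x y h => by
    rw [← hba x, ← hba y]
    exact congrArg (· * b) h
  have hj : ∀ (c) {B : Set (ℕ × ℕ × {c : S // c.1 1 = some 1})}, B.Finite →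
      {j : ℕ | (0, j, c) ∈ B}.Finite := by
    intro c B hB
    refine hB.preimage (f := fun j : ℕ => ((0 : ℕ), j, c)) ?_
    intro j _ j' _ h
    simpa using h
  obtain ⟨o, ho⟩ : ∃ o : {c : S // c.1 1 = some 1}, o.1.1 = 1 :=
    ⟨⟨⟨1, hCS one_mem_bicyclicN⟩, PEquiv.one_eq_some.2 rfl⟩, rfl⟩
  have key : (f ⁻¹' A)ᶜ.Finite := by
    refine Set.Infinite.finite_compl_of_grid (A := f ⁻¹' A) o (hA.preimage ?_) ?_ ?_ ?_ ?_
    · rw [hbij.2.range_eq]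
      exact subset_univ _
    -- Multiplying by `β` is the move and multiplying by `α` undoes it, so an exception is a point
    -- that leaves `A` under one of the two.
    · refine ((hfin (hl b)).union
        (hfin ((hl a).preimage (f := fun x => b * x) hcol.injOn))).subset ?_
      rintro ⟨i, j, c⟩ h
      have e : a * f (i + 1, j, c) = f (i, j, c) := by rw [← hbf, hab]
      simp only [mem_ofPred_eq, mem_union, mem_preimage, hbf, e] at h ⊢
      tauto
    · refine ((hfin (hr a)).union
        (hfin ((hr b).preimage (f := fun x => x * a) hrow.injOn))).subset ?_
      rintro ⟨i, j, c⟩ h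
      have e : f (i, j + 1, c) * b = f (i, j, c) := by rw [← hfa, hba]
      simp only [mem_ofPred_eq, mem_union, mem_preimage, hfa, e] at h ⊢
      tauto
    -- Left multiplication by `α ^ m` sends `c * α ^ j` to `α ^ (m + j)`; for the way back, `c`
    -- sends `α ^ j` to `c * α ^ j`.
    · intro c
      obtain ⟨m, hm⟩ := INInfty.exists_shiftUp_pow_mul_eq (hS c.1.2) c.2
      refine ⟨m, (hj c (hfin (hl ⟨_, hCS (shiftUp_pow_mem_bicyclicN m)⟩))).subset ?_⟩
      rintro j ⟨h1, h2⟩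
      refine ⟨h1, fun h3 => h2 ?_⟩
      rw [mem_preimage]
      convert h3
      refine Subtype.ext ?_
      rw [MulMemClass.coe_mul, fval, fval, ho, pow_zero, one_mul, one_mul, one_mul, ← mul_assoc, hm,
        pow_add]
    · intro c
      refine (hj o (hfin (hl c.1))).subset ?_
      rintro j ⟨h1, h2⟩
      refine ⟨h1, fun h3 => h2 ?_⟩
      rw [mem_preimage]
      convert h3
      refine Subtype.ext ?_
      rw [MulMemClass.coe_mul, fval, fval, ho, pow_zero, one_mul, one_mul, one_mul]
  have := key.image f
  rwa [← preimage_compl, image_preimage_eq _ hbij.2] at this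

end BetweenBicyclicAndIsometries

/-! ### Isolated points -/

/-- In a T1 space the points of a finite open set are isolated. -/
theorem Set.Finite.isOpen_singleton_of_mem {X : Type*} [TopologicalSpace X] [T1Space X] {O : Set X}
    (hf : O.Finite) (hO : IsOpen O) {x : X} (hx : x ∈ O) : IsOpen {x} := by
  have h : {x} = O \ (O \ {x}) := by
    rw [sdiff_sdiff_right_self]
    exact (inter_eq_right.2 (singleton_subset_iff.2 hx)).symm
  rw [h]
  exact hO.sdiff (hf.sdiff).isClosed

/-- A nonempty countable open subset of a locally compact Hausdorff space has an isolated point. -/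
theorem IsOpen.exists_isOpen_singleton_of_countable {X : Type*} [TopologicalSpace X] [T2Space X]
    [LocallyCompactSpace X] {O : Set X} (hO : IsOpen O) (hc : O.Countable) (hne : O.Nonempty) :
    ∃ x ∈ O, IsOpen {x} := by
  have := hO.locallyCompactSpace
  have := hc.to_subtype
  have := hne.to_subtype
  obtain ⟨x, hx⟩ := nonempty_interior_of_iUnion_of_closed (f := fun x : O => {x})
    (fun x => isClosed_singleton) (iUnion_of_singleton O)
  refine ⟨x, x.2, ?_⟩
  have h : IsOpen ({x} : Set O) := by
    rw [← interior_eq_iff_isOpen]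
    exact (subset_singleton_iff_eq.1 interior_subset).resolve_left hx.ne_empty
  simpa using hO.isOpenMap_subtype_val _ h

/-! ### The dichotomy -/

/-- `X` is the semigroup `S ⊔ I`: `ι` identifies `S` with a subsemigroup of `X` whose complement is
the ideal `I`. -/
theorem theorem3p15
    (S : Subsemigroup (ℕ+ ≃. ℕ+))
    (hS : S ≤ INInfty.toSubsemigroup)
    (hCS : bicyclicN ≤ S)
    {X : Type*} [Semigroup X] [TopologicalSpace X] [T2Space X] [LocallyCompactSpace X]
    [SeparatelyContinuousMul X]
    (ι : S →ₙ* X) (hι : Function.Injective ι)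
    (I : Set X) (hSI : IsCompl (Set.range ι) I)
    (hI : IsSemigroupIdeal I) (hIc : IsCompact I) :
    CompactSpace X ∨ IsOpen I := by
  have hcompl : Iᶜ = range ι := hSI.compl_eq.symm ▸ compl_compl _
  have hopen : IsOpen (range ι) := hcompl ▸ hIc.isClosed.isOpen_compl
  have := countable_of_le_INInfty hS hCS
  have hone : (1 : ℕ+ ≃. ℕ+) ∈ S := hCS one_mem_bicyclicN
  have finl : ∀ s u : S, {t : S | s * t = u}.Finite := fun s u =>
    ((INInfty.finite_setOf_mul_left_eq (hS s.2) u).preimage Subtype.val_injective.injOn).subset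
      fun t ht => ⟨hS t.2, congrArg Subtype.val ht⟩
  have finr : ∀ s u : S, {t : S | t * s = u}.Finite := fun s u =>
    ((INInfty.finite_setOf_mul_right_eq (hS s.2) u).preimage Subtype.val_injective.injOn).subset
      fun t ht => ⟨hS t.2, congrArg Subtype.val ht⟩
  -- preimages of isolated points under finite-to-one continuous maps are isolated
  have pull : ∀ (f : S → S) (g : X → X), Continuous g → (∀ t, g (ι t) = ι (f t)) →
      ∀ t, {t' : S | f t' = f t}.Finite → IsOpen {ι (f t)} → IsOpen {ι t} := by
    intro f g hg hgf t hfin ho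
    have h : range ι ∩ g ⁻¹' {ι (f t)} = ι '' {t' : S | f t' = f t} := by
      ext x
      constructor
      · rintro ⟨⟨t', rfl⟩, h⟩
        rw [mem_preimage, hgf, mem_singleton_iff] at h
        exact ⟨t', hι h, rfl⟩
      · rintro ⟨t', h, rfl⟩
        rw [mem_ofPred_eq] at h
        exact ⟨⟨t', rfl⟩, by rw [mem_preimage, hgf, h]; rfl⟩
    exact (hfin.image ι).isOpen_singleton_of_mem (h ▸ hopen.inter (ho.preimage hg))
      ⟨t, rfl, rfl⟩
  -- Left translation by an isolated `s` sends `1` to `s`, so `1` is isolated too.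
  have hdisc_one : IsOpen {ι ⟨1, hone⟩} := by
    obtain ⟨_, ⟨s, rfl⟩, hs⟩ := hopen.exists_isOpen_singleton_of_countable
      (countable_range ι) ⟨_, ⟨1, hone⟩, rfl⟩
    have h1 : s * ⟨1, hone⟩ = s := Subtype.ext (mul_one _)
    exact pull (fun t => s * t) (fun x => ι s * x) (continuous_const_mul _)
      (fun t => (map_mul ι s t).symm) _ (finl s _) (by rwa [h1])
  -- The map `t ↦ p * t * q` takes the given element to the isolated point `1`: `p` strips `β ^ i`
  -- and absorbs `c`, and `q` cancels the remaining power of `α`.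
  have hdisc : ∀ t, IsOpen {ι t} := by
    intro t
    obtain ⟨⟨i, j, c⟩, rfl⟩ := (gridElement_bijective hS hCS).2 t
    obtain ⟨m, hm⟩ := INInfty.exists_shiftUp_pow_mul_eq (hS c.1.2) c.2
    obtain ⟨p, hp⟩ : ∃ p : S, p.1 = shiftUp ^ (m + i) :=
      ⟨⟨_, hCS (shiftUp_pow_mem_bicyclicN _)⟩, rfl⟩
    obtain ⟨q, hq⟩ : ∃ q : S, q.1 = shiftDown ^ (m + j) :=
      ⟨⟨_, hCS (shiftDown_pow_mem_bicyclicN _)⟩, rfl⟩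
    have h1 : p * gridElement hCS (i, j, c) * q = ⟨1, hone⟩ := by
      refine Subtype.ext ?_
      rw [MulMemClass.coe_mul, MulMemClass.coe_mul, hp, hq, gridElement, pow_add]
      calc shiftUp ^ m * shiftUp ^ i * (shiftDown ^ i * c.1.1 * shiftUp ^ j) * shiftDown ^ (m + j)
        _ = shiftUp ^ m * (shiftUp ^ i * shiftDown ^ i) * c.1.1 * shiftUp ^ j *
            shiftDown ^ (m + j) := by simp only [mul_assoc]
        _ = shiftUp ^ (m + j) * shiftDown ^ (m + j) := by
          rw [shiftUp_pow_mul_shiftDown_pow, mul_one, hm, pow_add shiftUp]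
        _ = 1 := shiftUp_pow_mul_shiftDown_pow _
    refine pull (fun t => p * t * q) (fun x => ι p * x * ι q)
      ((continuous_mul_const _).comp (continuous_const_mul _))
      (fun t => by rw [map_mul, map_mul]) _ ?_ (by rwa [h1])
    exact (finr q _).preimage' (f := fun t => p * t) fun b _ => finl p b
  obtain ⟨K, hK, hIK⟩ := exists_compact_superset hIc
  have hU : IsOpen (interior K) := isOpen_interior
  have hdiff : ∀ V : Set X, IsOpen V → I ⊆ V → (K \ V).Finite := by
    intro V hV hIV
    refine (hK.diff hV).finite (isDiscrete_iff_forall_mem_exists_isOpen.2 fun x hx => ?_)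
    obtain ⟨t, rfl⟩ : x ∈ range ι := hcompl ▸ fun h => hx.2 (hIV h)
    exact ⟨_, hdisc t, inter_eq_left.2 (singleton_subset_iff.2 hx)⟩
  obtain ⟨A, hA⟩ : ∃ A, A = ι ⁻¹' interior K := ⟨_, rfl⟩
  have htrans : ∀ (f : S → S) (g : X → X), Continuous g → (∀ t, g (ι t) = ι (f t)) →
      (∀ x ∈ I, g x ∈ I) → {t | t ∈ A ∧ f t ∉ A}.Finite := by
    intro f g hg hgf hgI
    refine ((hdiff (g ⁻¹' interior K) (hU.preimage hg) fun x hx => hIK (hgI x hx)).preimage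
      hι.injOn).subset ?_
    rintro t ⟨h1, h2⟩
    rw [hA] at h1 h2
    refine ⟨interior_subset h1, fun h3 => h2 ?_⟩
    rw [mem_preimage, hgf] at h3
    exact h3
  by_cases hAf : A.Finite
  · right
    have h : I = interior K \ ι '' A := by
      ext x
      constructor
      · intro hx
        refine ⟨hIK hx, ?_⟩
        rintro ⟨t, -, rfl⟩
        exact hSI.disjoint.le_bot ⟨⟨t, rfl⟩, hx⟩
      · rintro ⟨hx, hx'⟩
        by_contra h
        obtain ⟨t, rfl⟩ : x ∈ range ι := hcompl ▸ h
        exact hx' ⟨t, hA ▸ hx, rfl⟩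
    rw [h]
    exact hU.sdiff (hAf.image ι).isClosed
  · left
    have hAc : Aᶜ.Finite := Set.Infinite.finite_compl_of_translations hS hCS hAf
      (fun s => htrans _ (fun x => ι s * x) (continuous_const_mul _)
        (fun t => (map_mul ι s t).symm) fun x hx => (hI x hx _).1)
      (fun s => htrans (fun t => t * s) (fun x => x * ι s) (continuous_mul_const _)
        (fun t => (map_mul ι t s).symm) fun x hx => (hI x hx _).2)
    refine ⟨(hK.union (hAc.image ι).isCompact).of_isClosed_subset isClosed_univ fun x _ => ?_⟩
    by_cases hx : x ∈ I
    · exact Or.inl (interior_subset (hIK hx))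
    · obtain ⟨t, rfl⟩ : x ∈ range ι := hcompl ▸ hx
      by_cases ht : t ∈ A
      · rw [hA] at ht
        exact Or.inl (interior_subset ht)
      · exact Or.inr ⟨t, ht, rfl⟩
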